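/- All graphs are finite, simple and undirected. For a connected graph $G$, let $rc(G)$ (the rainbow connection number) be the least number of colours in a colouring of the edges of $G$ (not necessarily proper) such that every pair of vertices is joined by a path no two edges of which have the same colour. Then: (1) Every connected graph $G$ with $n$ vertices and minimum degree $\delta$ satisfies $$rc(G) \le \frac{3n}{\delta+1} + 3.$$ (2) For every integer $\delta \ge 2$ there are infinitely many $n$ for which there exists a connected graph $G$ on $n$ vertices with minimum degree $\delta$ such that $$rc(G) \ge \frac{3(n-2)}{\delta+1} - 1.$$ In particular, there are infinitely many pairwise non-isomorphic such graphs. -/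

import Mathlib

namespace SimpleGraph

/-- A walk is a rainbow path with respect to an edge colouring `c` if it is a path (no repeated
vertices) and no two distinct edges of it have the same colour. -/
def IsRainbowPath {V K : Type*} {G : SimpleGraph V} (c : G.EdgeLabeling K) {u v : V}
    (p : G.Walk u v) : Prop :=
  p.IsPath ∧ ∀ e f : G.edgeSet, (e : Sym2 V) ∈ p.edges → (f : Sym2 V) ∈ p.edges → c e = c f → e = f

/-- A rainbow colouring: every pair of vertices is connected by at least one rainbow path. -/
def IsRainbowColoring {V K : Type*} {G : SimpleGraph V} (c : G.EdgeLabeling K) : Prop :=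
  ∀ u v : V, ∃ p : G.Walk u v, IsRainbowPath c p

/-- `G` has a rainbow colouring with colours from a set of `k` colours. -/
def RainbowColorable {V : Type*} (G : SimpleGraph V) (k : ℕ) : Prop :=
  ∃ c : G.EdgeLabeling (Fin k), IsRainbowColoring c

/-- The rainbow connection number `rc(G)`: the least number of colours of a rainbow colouring.
It is meaningful for finite connected graphs, where the minimum is over a nonempty set and so is
attained, by `rainbowColorable_rainbowConnectionNumber` below. -/
noncomputable def rainbowConnectionNumber {V : Type*} (G : SimpleGraph V) : ℕ :=
  sInf {k : ℕ | G.RainbowColorable k}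

theorem rainbowColorable_rainbowConnectionNumber {V : Type*} [Finite V] (G : SimpleGraph V)
    (hG : G.Connected) : G.RainbowColorable G.rainbowConnectionNumber := by
  classical
  refine Nat.sInf_mem (s := {k : ℕ | G.RainbowColorable k}) ⟨Nat.card G.edgeSet, ?_⟩
  refine ⟨fun e => Finite.equivFin G.edgeSet e, fun u v => ?_⟩
  obtain ⟨p, hp⟩ := (hG.preconnected u v).exists_isPath
  exact ⟨p, hp, fun e f _ _ h => (Finite.equivFin G.edgeSet).injective h⟩

end SimpleGraph

/-! Upper bound, δ ≥ 2: among sets D connected by an edge set E with (|E| + 3)(δ + 1) ≤ 3|N[D]|,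
take one with |N[D]| maximal. Attaching a vertex v by a path of length l adds at most l edges and
gains N[v] \ N[D]. Maximality therefore puts every vertex within distance 2 of D and gives each
vertex outside N[D] two neighbours in N[D] (`exists_isSparseCore`). Private colours on E and six
more off E suffice (`rainbowColorable_of_levels`), and |E| + 6 ≤ 3n/(δ + 1) + 3. For δ ≤ 1 a
spanning tree is enough.

Lower bound: a rainbow path has at most as many edges as there are colours, so rc is at least the
diameter. A chain of blocks of δ + 1 vertices, each spread over three levels, has minimum degree δ
and large diameter. -/

namespace SimpleGraph

/-! ### Six extra colours outside a connected core -/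

/-- A colouring of all pairs of vertices for which any two vertices are joined by a walk with
injectively coloured edges gives a rainbow colouring. -/
theorem rainbowColorable_of_walks {V K : Type*} [Fintype K] {G : SimpleGraph V} (f : Sym2 V → K)
    (h : ∀ u v, ∃ p : G.Walk u v, ∀ e ∈ p.edges, ∀ e' ∈ p.edges, f e = f e' → e = e') :
    G.RainbowColorable (Fintype.card K) := by
  classical
  refine ⟨fun e => Fintype.equivFin K (f e), fun u v => ?_⟩
  obtain ⟨p, hp⟩ := h u v
  refine ⟨p.bypass, p.bypass_isPath, fun e e' he he' hee => Subtype.ext ?_⟩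
  exact hp _ (p.edges_bypass_subset_edges he) _ (p.edges_bypass_subset_edges he')
    ((Fintype.equivFin K).injective hee)

/-- A 2-colouring of the vertices such that each non-isolated vertex has a neighbour of the other
colour. -/
theorem exists_bool_forall_adj_ne {V : Type*} (F : SimpleGraph V) :
    ∃ χ : V → Bool, ∀ v, (∃ w, F.Adj v w) → ∃ w, F.Adj v w ∧ χ w ≠ χ v := by
  classical
  have hroot (v : V) : F.Reachable v (F.connectedComponentMk v).out :=
    ConnectedComponent.exact (Quot.out_eq _).symm
  have hcongr {v w : V} (h : F.Adj v w) :
      (F.connectedComponentMk w).out = (F.connectedComponentMk v).out := by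
    rw [ConnectedComponent.sound h.reachable]
  -- Parity of the distance to a root of the component: the next vertex on a geodesic to the root
  -- has the other parity, and every neighbour of the root is at distance 1.
  refine ⟨fun v => decide (Even (F.dist v (F.connectedComponentMk v).out)), ?_⟩
  rintro v ⟨w, hw⟩
  obtain ⟨p, hp⟩ := (hroot v).exists_walk_length_eq_dist
  generalize hr : (F.connectedComponentMk v).out = r at p hp
  cases p with
  | nil =>
    refine ⟨w, hw, ?_⟩
    have : F.dist w v = 1 := dist_eq_one_iff_adj.2 hw.symm
    simp [hcongr hw, hr, this]
  | @cons _ x _ hx q =>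
    refine ⟨x, hx, ?_⟩
    have h1 : F.dist x r ≤ q.length := dist_le q
    obtain ⟨q', hq'⟩ := q.reachable.exists_walk_length_eq_dist
    have h2 : F.dist v r ≤ (Walk.cons hx q').length := dist_le _
    simp only [Walk.length_cons] at hp h2
    have h3 : F.dist v r = F.dist x r + 1 := by omega
    simp only [hcongr hx, hr, h3, Nat.even_add_one, ne_eq, decide_eq_decide]
    tauto

/-- A colouring of pairs that is prescribed on pairs of different level by the vertex of higher
level, and constant on pairs of the same level. -/
theorem exists_sym2_coloring_of_levels {V K : Type*} (lvl : V → ℕ) (h : V → V → K) (k : K) :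
    ∃ g : Sym2 V → K, (∀ u v, lvl v < lvl u → g s(u, v) = h u v) ∧
      ∀ u v, lvl u = lvl v → g s(u, v) = k := by
  refine ⟨Sym2.lift ⟨fun u v => if lvl v < lvl u then h u v else
    if lvl u < lvl v then h v u else k, fun u v => ?_⟩, ?_, ?_⟩
  · by_cases h1 : lvl v < lvl u
    · simp [h1, h1.le]
    · by_cases h2 : lvl u < lvl v <;> simp [h1, h2]
  · intro u v huv
    simp [huv]
  · intro u v huv
    simp [huv]

/-- A walk from `v` to a vertex of `D` whose edges outside `E` have distinct colours, all
from `S`. -/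
def HasRoute {V K : Type*} (G : SimpleGraph V) (E : Finset (Sym2 V)) (g : Sym2 V → K) (D : Set V)
    (S : Set K) (v : V) : Prop :=
  ∃ d ∈ D, ∃ p : G.Walk v d, (∀ e ∈ p.edges, e ∉ E → g e ∈ S) ∧
    ∀ e ∈ p.edges, ∀ e' ∈ p.edges, e ∉ E → e' ∉ E → g e = g e' → e = e'

section HasRoute

variable {V K : Type*} {G : SimpleGraph V} {E : Finset (Sym2 V)} {g : Sym2 V → K} {D : Set V}
  {S T : Set K} {u v : V}

theorem HasRoute.of_mem (h : v ∈ D) : HasRoute G E g D S v :=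
  ⟨v, h, .nil, by simp, by simp⟩

theorem HasRoute.cons (h : HasRoute G E g D S v) (huv : G.Adj u v) (hS : g s(u, v) ∉ S)
    (hT : g s(u, v) ∈ T) (hST : S ⊆ T) : HasRoute G E g D T u := by
  obtain ⟨d, hd, p, hp, hp'⟩ := h
  refine ⟨d, hd, .cons huv p, ?_, ?_⟩
  · intro e he hE
    rw [Walk.edges_cons, List.mem_cons] at he
    rcases he with rfl | he
    · exact hT
    · exact hST (hp e he hE)
  · intro e he e' he' hE hE' hee
    rw [Walk.edges_cons, List.mem_cons] at he he'
    rcases he with rfl | he <;> rcases he' with rfl | he'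
    · rfl
    · exact absurd (hee ▸ hp e' he' hE') hS
    · exact absurd (hee ▸ hp e he hE) hS
    · exact hp' e he e' he' hE hE' hee

theorem HasRoute.leg (huv : G.Adj u v) (hv : v ∈ D) (hT : g s(u, v) ∈ T) :
    HasRoute G E g D T u :=
  (HasRoute.of_mem (S := ∅) hv).cons huv (by simp) hT (by simp)

/-- Enter the core from both ends and join the entry points inside `E`. Edges of `E` will have
private colours, so only the two palettes can clash. -/
theorem HasRoute.exists_walk (hD : ∀ x ∈ D, ∀ y ∈ D, ∃ p : G.Walk x y, ∀ e ∈ p.edges, e ∈ E)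
    (hST : Disjoint S T) (hu : HasRoute G E g D S u) (hv : HasRoute G E g D T v) :
    ∃ p : G.Walk u v, ∀ e ∈ p.edges, ∀ e' ∈ p.edges, e ∉ E → e' ∉ E → g e = g e' → e = e' := by
  obtain ⟨x, hx, p, hp, hp'⟩ := hu
  obtain ⟨y, hy, q, hq, hq'⟩ := hv
  obtain ⟨r, hr⟩ := hD x hx y hy
  refine ⟨(p.append r).append q.reverse, ?_⟩
  intro e he e' he' hE hE' hee
  simp only [Walk.edges_append, Walk.edges_reverse, List.mem_append, List.mem_reverse] at he he'
  rcases he with (he | he) | he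
  · rcases he' with (he' | he') | he'
    · exact hp' e he e' he' hE hE' hee
    · exact absurd (hr _ he') hE'
    · exact absurd (hee ▸ hq e' he' hE') (Set.disjoint_left.1 hST (hp e he hE))
  · exact absurd (hr _ he) hE
  · rcases he' with (he' | he') | he'
    · exact absurd (hee ▸ hq e he hE) (Set.disjoint_left.1 hST (hp e' he' hE'))
    · exact absurd (hr _ he') hE'
    · exact hq' e he e' he' hE hE' hee

end HasRoute

/-- Edges of `E` get private colours, the other ones are coloured by `g`. -/
theorem rainbowColorable_of_walks_off {V K : Type*} [Fintype K] {G : SimpleGraph V}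
    (E : Finset (Sym2 V)) (g : Sym2 V → K)
    (h : ∀ u v, ∃ p : G.Walk u v,
      ∀ e ∈ p.edges, ∀ e' ∈ p.edges, e ∉ E → e' ∉ E → g e = g e' → e = e') :
    G.RainbowColorable (E.card + Fintype.card K) := by
  classical
  have := rainbowColorable_of_walks (G := G)
    (fun e => if he : e ∈ E then (Sum.inl ⟨e, he⟩ : E ⊕ K) else Sum.inr (g e)) fun u v => by
      obtain ⟨p, hp⟩ := h u v
      refine ⟨p, fun e he e' he' hee => ?_⟩
      by_cases hE : e ∈ E <;> by_cases hE' : e' ∈ E <;> simp [hE, hE'] at hee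
      · exact hee
      · exact hp e he e' he' hE hE' hee
  simpa using this

/-- Level 0 is the core. Each outer vertex gets routes to the core with several palettes, enough for
any two vertices to choose disjoint ones. -/
theorem rainbowColorable_of_levels {V : Type*} {G : SimpleGraph V} (E : Finset (Sym2 V))
    (lvl : V → ℕ) (hlvl : ∀ v, lvl v ≤ 2)
    (h0 : ∀ u v, lvl u = 0 → lvl v = 0 → ∃ p : G.Walk u v, ∀ e ∈ p.edges, e ∈ E)
    (h1 : ∀ v, lvl v = 1 → ∃ u, G.Adj v u ∧ lvl u = 0)
    (h2 : ∀ v, lvl v = 2 → ∃ a b, a ≠ b ∧ G.Adj v a ∧ G.Adj v b ∧ lvl a = 1 ∧ lvl b = 1)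
    (hdeg : ∀ v, ∃ a b, a ≠ b ∧ G.Adj v a ∧ G.Adj v b) :
    G.RainbowColorable (E.card + 6) := by
  classical
  -- An `F`-neighbour of the opposite class lets a level 1 vertex reach the core by a leg of the
  -- other colour, after at most two intermediate edges.
  let F : SimpleGraph V :=
    { Adj := fun x y => x ≠ y ∧ lvl x = 1 ∧ lvl y = 1 ∧
        (G.Adj x y ∨ ∃ w, lvl w = 2 ∧ G.Adj w x ∧ G.Adj w y)
      symm := ⟨by
        rintro x y ⟨hne, hx, hy, h | ⟨w, hw, hwx, hwy⟩⟩
        · exact ⟨hne.symm, hy, hx, .inl h.symm⟩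
        · exact ⟨hne.symm, hy, hx, .inr ⟨w, hw, hwy, hwx⟩⟩⟩
      loopless := ⟨fun x h => h.1 rfl⟩ }
  obtain ⟨χ, hχ⟩ := F.exists_bool_forall_adj_ne
  have hab (v : V) : ∃ a b, a ≠ b ∧ G.Adj v a ∧ G.Adj v b ∧
      (lvl v = 2 → lvl a = 1 ∧ lvl b = 1) := by
    by_cases hv : lvl v = 2
    · obtain ⟨a, b, hne, ha, hb, h⟩ := h2 v hv
      exact ⟨a, b, hne, ha, hb, fun _ => h⟩
    · obtain ⟨a, b, hne, ha, hb⟩ := hdeg v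
      exact ⟨a, b, hne, ha, hb, fun h => absurd h hv⟩
  choose a b hne ha hb hab2 using hab
  let col (t : Bool) : Fin 6 := if t then 1 else 0
  -- Colours 0 and 1 are for legs into the core, 3 and 4 for edges from mixed vertices according to
  -- the class of the lower end, 2 and 5 for edges from the other level 2 vertices. Edges within a
  -- level get 3.
  let mixed (w : V) : Prop := ∀ t : Bool, ∃ x, G.Adj w x ∧ lvl x = 1 ∧ χ x = t
  obtain ⟨g, hg, hg'⟩ := exists_sym2_coloring_of_levels lvl
    (fun u v => if lvl u = 1 then
        (if ∃ x, F.Adj u x then col (χ u) else if v = a u then 0 else 1)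
      else if mixed u then (if χ v then 4 else 3) else if v = a u then 2 else 5) (3 : Fin 6)
  -- colours of the various kinds of edges
  have g_leg {x d : V} (hx : lvl x = 1) (hd : lvl d = 0) (hF : ∃ y, F.Adj x y) :
      g s(x, d) = col (χ x) := by
    rw [hg x d (by omega), if_pos hx, if_pos hF]
  have g_mixed {w x : V} (hw : lvl w = 2) (hx : lvl x = 1) (hm : mixed w) :
      g s(w, x) = if χ x then 4 else 3 := by
    rw [hg w x (by omega), if_neg (by omega), if_pos hm]
  have g_a {w : V} (hw : lvl w = 2) (hm : ¬ mixed w) : g s(w, a w) = 2 := by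
    rw [hg w _ (by have := (hab2 w hw).1; omega), if_neg (by omega), if_neg hm, if_pos rfl]
  have g_b {w : V} (hw : lvl w = 2) (hm : ¬ mixed w) : g s(w, b w) = 5 := by
    rw [hg w _ (by have := (hab2 w hw).2; omega), if_neg (by omega), if_neg hm,
      if_neg (hne w).symm]
  let R (S : Set (Fin 6)) (v : V) : Prop := HasRoute G E g {v | lvl v = 0} S v
  -- a level 1 vertex reaches the core by a leg of its class, and also by a leg of the other class
  have r_own {x : V} (hx : lvl x = 1) (hF : ∃ y, F.Adj x y) : R {col (χ x)} x := by
    obtain ⟨d, hd, hd0⟩ := h1 x hx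
    exact HasRoute.leg hd hd0 (g_leg hx hd0 hF)
  have r_other {x : V} (hx : lvl x = 1) (hF : ∃ y, F.Adj x y) :
      R {col (!χ x), 3, 4} x := by
    obtain ⟨y, hxy, hne'⟩ := hχ x hF
    have hy : χ y = !χ x := Bool.eq_not.2 hne'
    have hyR := r_own hxy.2.2.1 ⟨x, hxy.symm⟩
    rw [hy] at hyR
    obtain ⟨-, -, hy1, hadj | ⟨w, hw, hwx, hwy⟩⟩ := hxy
    · have h3 : g s(x, y) = 3 := hg' x y (by omega)
      refine hyR.cons hadj ?_ ?_ (by simp) <;> rw [h3] <;> cases χ x <;> simp [col]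
    · have hm : mixed w := by
        intro t
        by_cases ht : χ x = t
        · exact ⟨x, hwx, hx, ht⟩
        · refine ⟨y, hwy, hy1, ?_⟩
          rw [hy, Bool.eq_not.2 ht, Bool.not_not]
      have e1 := g_mixed hw hx hm
      have e2 := g_mixed hw hy1 hm
      rw [hy] at e2
      have hwR : R (insert (g s(w, y)) {col (!χ x)}) w := by
        refine hyR.cons hwy ?_ (by simp) (by simp)
        rw [e2]; cases χ x <;> simp [col]
      rw [e2] at hwR
      rw [Sym2.eq_swap] at e1
      refine hwR.cons hwx.symm ?_ ?_ ?_
      · rw [e1]; cases χ x <;> simp [col]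
      · rw [e1]; cases χ x <;> simp
      · cases χ x <;> simp [Set.insert_subset_iff]
  have r_any {x : V} (hx : lvl x = 1) : ∃ t, R {col t} x ∧ R {col (!t), 3, 4} x := by
    by_cases hF : ∃ y, F.Adj x y
    · exact ⟨χ x, r_own hx hF, r_other hx hF⟩
    -- A level 2 neighbour would link `x` in `F` to another level 1 vertex. So an `F`-isolated `x`
    -- has all its neighbours, at least two, in the core, and legs of both colours.
    · have key {y : V} (hy : G.Adj x y) : lvl y = 0 := by
        by_contra hy0
        have : lvl y = 1 ∨ lvl y = 2 := by have := hlvl y; omega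
        rcases this with hy1 | hy2
        · exact hF ⟨y, hy.ne, hx, hy1, .inl hy⟩
        · by_cases hax : a y = x
          · exact hF ⟨b y, fun h => hne y (hax.trans h), hx, (hab2 y hy2).2,
              .inr ⟨y, hy2, hy.symm, hb y⟩⟩
          · exact hF ⟨a y, Ne.symm hax, hx, (hab2 y hy2).1, .inr ⟨y, hy2, hy.symm, ha y⟩⟩
      refine ⟨false, HasRoute.leg (ha x) (key (ha x)) ?_, HasRoute.leg (hb x) (key (hb x)) ?_⟩
      · rw [hg _ _ (by rw [key (ha x)]; omega), if_pos hx, if_neg hF, if_pos rfl]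
        simp [col]
      · rw [hg _ _ (by rw [key (hb x)]; omega), if_pos hx, if_neg hF, if_neg (hne x).symm]
        simp [col]
  have hFw {w x : V} (hw : lvl w = 2) (hx : lvl x = 1) (hwx : G.Adj w x) : ∃ y, F.Adj x y := by
    by_cases hax : a w = x
    · exact ⟨b w, fun h => hne w (hax.trans h), hx, (hab2 w hw).2, .inr ⟨w, hw, hwx, hb w⟩⟩
    · exact ⟨a w, Ne.symm hax, hx, (hab2 w hw).1, .inr ⟨w, hw, hwx, ha w⟩⟩
  have r_mixed {w : V} (hw : lvl w = 2) (hm : mixed w) (t : Bool) :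
      R {col t, if t then 4 else 3} w := by
    obtain ⟨x, hwx, hx, hxt⟩ := hm t
    have hxR := r_own hx (hFw hw hx hwx)
    have e := g_mixed hw hx hm
    rw [hxt] at hxR e
    refine hxR.cons hwx ?_ ?_ (by simp) <;> rw [e] <;> cases t <;> simp [col]
  -- Both `a w` and `b w` lie in one class. The first two palettes separate non-mixed vertices of
  -- different classes; the third, which switches class after `b w`, avoids {col t, 2} for those of
  -- the same class.
  have r_mono {w : V} (hw : lvl w = 2) (hm : ¬ mixed w) :
      ∃ t, R {col t, 2} w ∧ R {col t, 5} w ∧ R {col (!t), 3, 4, 5} w := by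
    have hA := (hab2 w hw).1
    have hB := (hab2 w hw).2
    have hχab : χ (a w) = χ (b w) := by
      by_contra hc
      refine hm fun t => ?_
      by_cases ht : χ (a w) = t
      · exact ⟨_, ha w, hA, ht⟩
      · refine ⟨_, hb w, hB, ?_⟩
        rw [← Bool.not_inj_iff, ← Bool.eq_not.2 hc, Bool.eq_not.2 ht]
    refine ⟨χ (b w), ?_, ?_, ?_⟩
    · rw [← hχab]
      refine (r_own hA (hFw hw hA (ha w))).cons (ha w) ?_ ?_ (by simp) <;> rw [g_a hw hm]
      · cases χ (a w) <;> simp [col]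
      · simp
    · refine (r_own hB (hFw hw hB (hb w))).cons (hb w) ?_ ?_ (by simp) <;> rw [g_b hw hm]
      · cases χ (b w) <;> simp [col]
      · simp
    · refine (r_other hB (hFw hw hB (hb w))).cons (hb w) ?_ ?_ ?_
      · rw [g_b hw hm]; cases χ (b w) <;> simp [col]
      · rw [g_b hw hm]; simp
      · simp [Set.insert_subset_iff]
  have hD : ∀ x ∈ {v | lvl v = 0}, ∀ y ∈ {v | lvl v = 0},
      ∃ p : G.Walk x y, ∀ e ∈ p.edges, e ∈ E := fun x hx y hy => h0 x y hx hy
  -- every pair of vertices has routes with disjoint sets of colours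
  have main (u v : V) (huv : lvl u ≤ lvl v) : ∃ S T, Disjoint S T ∧ R S u ∧ R T v := by
    have hv2 := hlvl v
    have cases012 : lvl u = 0 ∨ (lvl u = 1 ∧ lvl v = 1) ∨ (lvl u = 1 ∧ lvl v = 2) ∨
      (lvl u = 2 ∧ lvl v = 2) := by omega
    have dj (t : Bool) : Disjoint ({col t} : Set (Fin 6)) {col (!t), 3, 4} := by
      cases t <;> simp [col]
    rcases cases012 with hu | ⟨hu, hv⟩ | ⟨hu, hv⟩ | ⟨hu, hv⟩
    · have : ∃ T, R T v := by
        have : lvl v = 0 ∨ lvl v = 1 ∨ lvl v = 2 := by omega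
        rcases this with hv | hv | hv
        · exact ⟨∅, HasRoute.of_mem hv⟩
        · obtain ⟨t, h, -⟩ := r_any hv
          exact ⟨_, h⟩
        · by_cases hm : mixed v
          · exact ⟨_, r_mixed hv hm true⟩
          · obtain ⟨t, h, -⟩ := r_mono hv hm
            exact ⟨_, h⟩
      obtain ⟨T, hT⟩ := this
      exact ⟨∅, T, by simp, HasRoute.of_mem hu, hT⟩
    · obtain ⟨t, ht, ht'⟩ := r_any hu
      obtain ⟨s, hs, hs'⟩ := r_any hv
      by_cases hst : s = t
      · subst hst
        exact ⟨_, _, dj s, ht, hs'⟩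
      · obtain rfl := Bool.eq_not.2 hst
        refine ⟨_, _, ?_, ht, hs⟩
        cases t <;> simp [col]
    · obtain ⟨t, ht, ht'⟩ := r_any hu
      by_cases hm : mixed v
      · refine ⟨_, _, ?_, ht, r_mixed hv hm (!t)⟩
        cases t <;> simp [col]
      · obtain ⟨s, hs, -, -⟩ := r_mono hv hm
        by_cases hst : s = t
        · subst hst
          refine ⟨_, _, ?_, ht', hs⟩
          cases s <;> simp [col]
        · obtain rfl := Bool.eq_not.2 hst
          refine ⟨_, _, ?_, ht, hs⟩
          cases t <;> simp [col]
    · by_cases hmu : mixed u <;> by_cases hmv : mixed v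
      · refine ⟨_, _, ?_, r_mixed hu hmu true, r_mixed hv hmv false⟩
        simp [col]
      · obtain ⟨s, hs, -, -⟩ := r_mono hv hmv
        refine ⟨_, _, ?_, r_mixed hu hmu (!s), hs⟩
        cases s <;> simp [col]
      · obtain ⟨s, hs, -, -⟩ := r_mono hu hmu
        refine ⟨_, _, ?_, hs, r_mixed hv hmv (!s)⟩
        cases s <;> simp [col]
      · obtain ⟨s, hs, -, -⟩ := r_mono hu hmu
        obtain ⟨t, -, ht, ht'⟩ := r_mono hv hmv
        by_cases hst : s = t
        · subst hst
          refine ⟨_, _, ?_, hs, ht'⟩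
          cases s <;> simp [col]
        · obtain rfl := Bool.eq_not.2 hst
          refine ⟨_, _, ?_, hs, ht⟩
          cases t <;> simp [col]
  have := rainbowColorable_of_walks_off (G := G) E g fun u v => by
    rcases le_total (lvl u) (lvl v) with h | h
    · obtain ⟨S, T, hST, hu, hv⟩ := main u v h
      exact HasRoute.exists_walk hD hST hu hv
    · obtain ⟨S, T, hST, hv, hu⟩ := main v u h
      exact HasRoute.exists_walk hD hST.symm hu hv
  simpa using this

end SimpleGraph

/-! ### Sparse cores and the upper bound -/

namespace SimpleGraph

/-- `E` connects the vertices of `D`. -/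
def ConnectsIn {V : Type*} (G : SimpleGraph V) (E : Finset (Sym2 V)) (D : Finset V) : Prop :=
  ∀ u ∈ D, ∀ v ∈ D, ∃ p : G.Walk u v, ∀ e ∈ p.edges, e ∈ E

theorem ConnectsIn.union_walk {V : Type*} [DecidableEq V] {G : SimpleGraph V}
    {E : Finset (Sym2 V)} {D : Finset V} (h : G.ConnectsIn E D) {d v : V} (hd : d ∈ D)
    (q : G.Walk d v) :
    G.ConnectsIn (E ∪ q.edges.toFinset) (D ∪ q.support.toFinset) := by
  have key (u : V) (hu : u ∈ D ∪ q.support.toFinset) :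
      ∃ p : G.Walk d u, ∀ e ∈ p.edges, e ∈ E ∪ q.edges.toFinset := by
    rcases Finset.mem_union.1 hu with hu | hu
    · obtain ⟨p, hp⟩ := h d hd u hu
      exact ⟨p, fun e he => Finset.mem_union_left _ (hp e he)⟩
    · rw [List.mem_toFinset] at hu
      refine ⟨q.takeUntil u hu, fun e he => Finset.mem_union_right _ ?_⟩
      exact List.mem_toFinset.2 (q.edges_takeUntil_subset_edges hu he)
  intro u hu v hv
  obtain ⟨p, hp⟩ := key u hu
  obtain ⟨r, hr⟩ := key v hv
  refine ⟨p.reverse.append r, fun e he => ?_⟩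
  simp only [Walk.edges_append, Walk.edges_reverse, List.mem_append, List.mem_reverse] at he
  exact he.elim (hp e) (hr e)

section Domination

variable {V : Type*} [Fintype V] [DecidableEq V] (G : SimpleGraph V) [DecidableRel G.Adj]

/-- The closed neighbourhood of a set of vertices. -/
def closedNeighborFinset (D : Finset V) : Finset V :=
  Finset.univ.filter fun v => ∃ d ∈ D, d = v ∨ G.Adj d v

variable {G}

theorem mem_closedNeighborFinset {D : Finset V} {v : V} :
    v ∈ G.closedNeighborFinset D ↔ ∃ d ∈ D, d = v ∨ G.Adj d v := by
  simp [closedNeighborFinset]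

theorem closedNeighborFinset_mono {D D' : Finset V} (h : D ⊆ D') :
    G.closedNeighborFinset D ⊆ G.closedNeighborFinset D' := by
  intro v hv
  rw [mem_closedNeighborFinset] at hv ⊢
  obtain ⟨d, hd, hdv⟩ := hv
  exact ⟨d, h hd, hdv⟩

theorem card_closedNeighborFinset_singleton (v : V) :
    (G.closedNeighborFinset {v}).card = G.degree v + 1 := by
  have : G.closedNeighborFinset {v} = insert v (G.neighborFinset v) := by
    ext w
    simp [mem_closedNeighborFinset, eq_comm]
  rw [this, Finset.card_insert_of_notMem (by simp), card_neighborFinset_eq_degree]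

/-- `D` is nonempty and connected by `E`, and `E` is small in comparison with the closed
neighbourhood of `D`. -/
structure IsSparseCore (G : SimpleGraph V) [DecidableRel G.Adj] (δ : ℕ) (E : Finset (Sym2 V))
    (D : Finset V) : Prop where
  nonempty : D.Nonempty
  connects : G.ConnectsIn E D
  card_le : (E.card + 3) * (δ + 1) ≤ 3 * (G.closedNeighborFinset D).card

/-- Only the gain around the endpoint `v` is counted against the length of `q`. The strict growth
contradicts maximality in `exists_isSparseCore`. -/
theorem IsSparseCore.extend {δ : ℕ} {E : Finset (Sym2 V)} {D : Finset V}
    (h : G.IsSparseCore δ E D) {d v : V} (hd : d ∈ D) (q : G.Walk d v)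
    (hv : v ∉ G.closedNeighborFinset D)
    (hq : q.length * (δ + 1) ≤
      3 * (G.closedNeighborFinset {v} \ G.closedNeighborFinset D).card) :
    ∃ E' D', G.IsSparseCore δ E' D' ∧
      (G.closedNeighborFinset D).card < (G.closedNeighborFinset D').card := by
  have hsub : G.closedNeighborFinset D ∪
      (G.closedNeighborFinset {v} \ G.closedNeighborFinset D) ⊆
      G.closedNeighborFinset (D ∪ q.support.toFinset) := by
    refine Finset.union_subset (closedNeighborFinset_mono Finset.subset_union_left)
      (Finset.sdiff_subset.trans (closedNeighborFinset_mono ?_))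
    simp
  have hcard := Finset.card_le_card hsub
  rw [Finset.card_union_of_disjoint Finset.disjoint_sdiff] at hcard
  have hpos : 0 < (G.closedNeighborFinset {v} \ G.closedNeighborFinset D).card :=
    Finset.card_pos.2 ⟨v, Finset.mem_sdiff.2 ⟨mem_closedNeighborFinset.2 ⟨v, by simp⟩, hv⟩⟩
  refine ⟨_, _, ⟨h.nonempty.mono Finset.subset_union_left, h.connects.union_walk hd q, ?_⟩,
    by omega⟩
  have hE : (E ∪ q.edges.toFinset).card ≤ E.card + q.length := by
    refine (Finset.card_union_le _ _).trans (Nat.add_le_add_left ?_ _)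
    exact (List.toFinset_card_le _).trans q.length_edges.le
  calc ((E ∪ q.edges.toFinset).card + 3) * (δ + 1)
      ≤ (E.card + q.length + 3) * (δ + 1) := by gcongr
    _ = (E.card + 3) * (δ + 1) + q.length * (δ + 1) := by ring
    _ ≤ _ := by have := h.card_le; omega

/-- There is a sparse core for which each vertex that it does not dominate has two neighbours that
it dominates. -/
theorem exists_isSparseCore (hG : G.Connected) {δ : ℕ} (hδ : 2 ≤ δ) (hdeg : ∀ v, δ ≤ G.degree v) :
    ∃ E D, G.IsSparseCore δ E D ∧ ∀ v ∉ G.closedNeighborFinset D,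
      ∃ a ∈ G.closedNeighborFinset D, ∃ b ∈ G.closedNeighborFinset D,
        a ≠ b ∧ G.Adj v a ∧ G.Adj v b := by
  obtain ⟨u⟩ := hG.nonempty
  let s : Set (Finset (Sym2 V) × Finset V) := {x | G.IsSparseCore δ x.1 x.2}
  have hs : s.Nonempty := by
    -- A single vertex dominates at least δ + 1 vertices at no cost in edges, which pays for the + 3
    -- in `card_le`.
    refine ⟨(∅, {u}), by simp, ?_, ?_⟩
    · intro x hx y hy
      obtain rfl := Finset.mem_singleton.1 hx
      obtain rfl := Finset.mem_singleton.1 hy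
      exact ⟨.nil, by simp⟩
    · have := hdeg u
      simp only [card_closedNeighborFinset_singleton, Finset.card_empty]
      omega
  obtain ⟨⟨E, D⟩, h, hmax⟩ :=
    Set.exists_max_image s (fun x => (G.closedNeighborFinset x.2).card) (Set.toFinite s) hs
  have hmax' {d v : V} (hd : d ∈ D) (q : G.Walk d v) (hv : v ∉ G.closedNeighborFinset D) :
      3 * (G.closedNeighborFinset {v} \ G.closedNeighborFinset D).card <
        q.length * (δ + 1) := by
    by_contra hq
    obtain ⟨E', D', h', hlt⟩ := IsSparseCore.extend h hd q hv (not_lt.1 hq)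
    exact absurd (hmax (E', D') h') (not_le.2 hlt)
  refine ⟨E, D, h, fun v hv => ?_⟩
  have hsplit (w : V) := Finset.card_inter_add_card_sdiff (G.closedNeighborFinset {w})
    (G.closedNeighborFinset D)
  -- every vertex is at distance at most two from the core
  have hdist (w : V) : ∃ d ∈ D, ∃ q : G.Walk d w, q.length ≤ 2 := by
    by_contra hw
    obtain ⟨d, hd⟩ := h.nonempty
    obtain ⟨p⟩ := hG.preconnected d w
    -- Here `y` is reached by a walk of length at most 3 but not 2, so its closed neighbourhood
    -- misses that of `D`: at least δ + 1 new vertices for 3 edges.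
    obtain ⟨⟨⟨x, y⟩, hxy⟩, -, hx, hy⟩ := p.exists_boundary_dart
      {w | ∃ d ∈ D, ∃ q : G.Walk d w, q.length ≤ 2} ⟨d, hd, .nil, by simp⟩ hw
    obtain ⟨d', hd', q, hq⟩ := hx
    have hnot (z : V) (hz : z ∈ G.closedNeighborFinset {y}) : z ∉ G.closedNeighborFinset D := by
      intro hzD
      obtain ⟨c, hc, hcz⟩ := mem_closedNeighborFinset.1 hzD
      have hyz : y = z ∨ G.Adj y z := by simpa [mem_closedNeighborFinset] using hz
      refine hy ⟨c, hc, ?_⟩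
      rcases hcz with rfl | hcz <;> rcases hyz with rfl | hyz
      · exact ⟨.nil, by simp⟩
      · exact ⟨hyz.symm.toWalk, by simp⟩
      · exact ⟨hcz.toWalk, by simp⟩
      · exact ⟨.cons hcz hyz.symm.toWalk, by simp⟩
    have hyD := hnot y (mem_closedNeighborFinset.2 ⟨y, by simp⟩)
    have h3 := hmax' hd' (q.append (Walk.cons hxy .nil)) hyD
    rw [Finset.sdiff_eq_self_of_disjoint (Finset.disjoint_left.2 hnot),
      card_closedNeighborFinset_singleton] at h3
    simp only [Walk.length_append, Walk.length_cons, Walk.length_nil] at h3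
    have := hdeg y
    have : (q.length + (0 + 1)) * (δ + 1) ≤ 3 * (δ + 1) := by gcongr; omega
    omega
  obtain ⟨d, hd, q, hq⟩ := hdist v
  have h3 := hmax' hd q hv
  have h4 := hsplit v
  rw [card_closedNeighborFinset_singleton] at h4
  have := hdeg v
  have : q.length * (δ + 1) ≤ 2 * (δ + 1) := by gcongr
  -- Otherwise `v` would bring at least δ new vertices for two edges, and 2(δ + 1) ≤ 3δ because δ ≥
  -- 2.
  have h5 : 1 < (G.closedNeighborFinset {v} ∩ G.closedNeighborFinset D).card := by omega
  obtain ⟨a, ha, b, hb, hab⟩ := Finset.one_lt_card.1 h5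
  rw [Finset.mem_inter] at ha hb
  have hadj {z : V} (hz : z ∈ G.closedNeighborFinset {v} ∧ z ∈ G.closedNeighborFinset D) :
      G.Adj v z := by
    have : v = z ∨ G.Adj v z := by simpa [mem_closedNeighborFinset] using hz.1
    exact this.resolve_left fun hvz => hv (hvz ▸ hz.2)
  exact ⟨a, ha.2, b, hb.2, hab, hadj ha, hadj hb⟩

end Domination

theorem rainbowConnectionNumber_le_of_two_le {V : Type*} [Fintype V] {G : SimpleGraph V}
    [DecidableRel G.Adj] (hG : G.Connected) {δ : ℕ} (hδ : 2 ≤ δ) (hdeg : ∀ v, δ ≤ G.degree v) :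
    (G.rainbowConnectionNumber : ℝ) ≤ 3 * (Fintype.card V : ℝ) / ((δ : ℝ) + 1) + 3 := by
  classical
  obtain ⟨E, D, h, hD⟩ := exists_isSparseCore hG hδ hdeg
  have hsub : D ⊆ G.closedNeighborFinset D :=
    fun v hv => mem_closedNeighborFinset.2 ⟨v, hv, .inl rfl⟩
  let lvl (v : V) : ℕ := if v ∈ D then 0 else if v ∈ G.closedNeighborFinset D then 1 else 2
  have hlvl0 {v : V} : lvl v = 0 ↔ v ∈ D := by
    by_cases hv : v ∈ D <;> by_cases hv' : v ∈ G.closedNeighborFinset D <;> simp [lvl, hv, hv']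
  have hlvl2 {v : V} : lvl v = 2 ↔ v ∉ G.closedNeighborFinset D := by
    by_cases hv : v ∈ D
    · simp [lvl, hv, hsub hv]
    · by_cases hv' : v ∈ G.closedNeighborFinset D <;> simp [lvl, hv, hv']
  have hlvl (v : V) : lvl v ≤ 2 := by
    by_cases hv : v ∈ D <;> by_cases hv' : v ∈ G.closedNeighborFinset D <;> simp [lvl, hv, hv']
  have hcol : G.RainbowColorable (E.card + 6) := by
    refine rainbowColorable_of_levels E lvl hlvl ?_ ?_ ?_ ?_
    · intro u v hu hv
      exact h.connects u (hlvl0.1 hu) v (hlvl0.1 hv)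
    · intro v hv
      have hvD : v ∉ D := fun hv' => by rw [hlvl0.2 hv'] at hv; omega
      have hv2 : v ∈ G.closedNeighborFinset D := by
        by_contra hv'
        rw [hlvl2.2 hv'] at hv
        omega
      obtain ⟨d, hd, rfl | hdv⟩ := mem_closedNeighborFinset.1 hv2
      · exact absurd hd hvD
      · exact ⟨d, hdv.symm, hlvl0.2 hd⟩
    · intro v hv
      rw [hlvl2] at hv
      obtain ⟨a, ha, b, hb, hab, hva, hvb⟩ := hD v hv
      have key {z : V} (hz : z ∈ G.closedNeighborFinset D) (hvz : G.Adj v z) : lvl z = 1 := by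
        have hzD : z ∉ D := fun hz' => hv (mem_closedNeighborFinset.2 ⟨z, hz', .inr hvz.symm⟩)
        simp [lvl, hz, hzD]
      exact ⟨a, b, hab, hva, hvb, key ha hva, key hb hvb⟩
    · intro v
      have : 1 < (G.neighborFinset v).card := by
        rw [card_neighborFinset_eq_degree]
        have := hdeg v
        omega
      obtain ⟨a, ha, b, hb, hab⟩ := Finset.one_lt_card.1 this
      exact ⟨a, b, hab, by simpa using ha, by simpa using hb⟩
  have hle : G.rainbowConnectionNumber ≤ E.card + 6 := Nat.sInf_le hcol
  have hcard : (E.card + 3) * (δ + 1) ≤ 3 * Fintype.card V :=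
    h.card_le.trans (Nat.mul_le_mul_left _ (Finset.card_le_univ _))
  have hle' : (G.rainbowConnectionNumber : ℝ) ≤ E.card + 6 := by exact_mod_cast hle
  have hcard' : ((E.card : ℝ) + 3) * (δ + 1) ≤ 3 * Fintype.card V := by exact_mod_cast hcard
  have := (le_div_iff₀ (by positivity : (0 : ℝ) < δ + 1)).2 hcard'
  linarith

/-- The edges of a spanning tree with distinct colours, and one more colour. -/
theorem rainbowConnectionNumber_le_card {V : Type*} [Fintype V] {G : SimpleGraph V}
    (hG : G.Connected) : G.rainbowConnectionNumber ≤ Fintype.card V := by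
  classical
  obtain ⟨T, hTG, hT⟩ := hG.exists_isTree_le
  have := rainbowColorable_of_walks_off (G := G) T.edgeFinset (fun _ => ()) fun u v => by
    obtain ⟨p⟩ := hT.connected.preconnected u v
    refine ⟨p.mapLe hTG, fun e he e' _ hE => absurd ?_ hE⟩
    rw [Walk.edges_mapLe_eq_edges] at he
    exact mem_edgeFinset.2 (p.edges_subset_edgeSet he)
  rw [Fintype.card_unit, hT.card_edgeFinset] at this
  exact Nat.sInf_le this

theorem rainbowConnectionNumber_le {V : Type*} [Fintype V] (G : SimpleGraph V)
    [DecidableRel G.Adj] (hG : G.Connected) :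
    (G.rainbowConnectionNumber : ℝ) ≤
      3 * (Fintype.card V : ℝ) / ((G.minDegree : ℝ) + 1) + 3 := by
  rcases le_or_gt 2 G.minDegree with hδ | hδ
  · exact rainbowConnectionNumber_le_of_two_le hG hδ G.minDegree_le_degree
  -- For δ ≤ 1 the factor 3/(δ + 1) exceeds 1, so n colours are within the bound.
  · have h1 : (G.rainbowConnectionNumber : ℝ) ≤ Fintype.card V := by
      exact_mod_cast rainbowConnectionNumber_le_card hG
    have h2 : (G.minDegree : ℝ) ≤ 1 := by exact_mod_cast Nat.lt_succ_iff.1 hδ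
    have h3 : (Fintype.card V : ℝ) ≤ 3 * (Fintype.card V : ℝ) / ((G.minDegree : ℝ) + 1) := by
      rw [le_div_iff₀ (by positivity)]
      have : (0 : ℝ) ≤ Fintype.card V := by positivity
      nlinarith
    linarith

end SimpleGraph

/-! ### Layered graphs of large diameter and the lower bound -/

namespace SimpleGraph

theorem RainbowColorable.exists_walk_length_le {V : Type*} {G : SimpleGraph V} {k : ℕ}
    (h : G.RainbowColorable k) (u v : V) : ∃ p : G.Walk u v, p.length ≤ k := by
  classical
  obtain ⟨c, hc⟩ := h
  obtain ⟨p, hp, hinj⟩ := hc u v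
  refine ⟨p, ?_⟩
  have hmem (e : p.edges.toFinset) : (e : Sym2 V) ∈ p.edges := List.mem_toFinset.1 e.2
  have := Fintype.card_le_of_injective
    (fun e : p.edges.toFinset => c ⟨e, p.edges_subset_edgeSet (hmem e)⟩) fun e f hef =>
      Subtype.ext (congrArg (fun x : G.edgeSet => (x : Sym2 V)) (hinj _ _ (hmem e) (hmem f) hef))
  rwa [Fintype.card_coe, List.toFinset_card_of_nodup hp.isTrail.edges_nodup, Walk.length_edges,
    Fintype.card_fin] at this

/-- The graph in which two vertices are adjacent if their levels differ by at most one. -/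
def levelGraph {V : Type*} (lvl : V → ℕ) : SimpleGraph V where
  Adj u v := u ≠ v ∧ lvl u ≤ lvl v + 1 ∧ lvl v ≤ lvl u + 1
  symm := ⟨fun _ _ h => ⟨h.1.symm, h.2.2, h.2.1⟩⟩
  loopless := ⟨fun _ h => h.1 rfl⟩

section LevelGraph

variable {V : Type*} {lvl : V → ℕ}

theorem levelGraph_adj {u v : V} :
    (levelGraph lvl).Adj u v ↔ u ≠ v ∧ lvl u ≤ lvl v + 1 ∧ lvl v ≤ lvl u + 1 := Iff.rfl

theorem levelGraph_le_length {u v : V} (p : (levelGraph lvl).Walk u v) :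
    lvl v ≤ lvl u + p.length := by
  induction p with
  | nil => simp
  | cons h p ih =>
    have := h.2.2
    rw [Walk.length_cons]
    omega

/-- Descend level by level; level 0 is a clique. -/
theorem levelGraph_connected [Nonempty V] (h : ∀ v, 0 < lvl v → ∃ u, lvl u + 1 = lvl v) :
    (levelGraph lvl).Connected := by
  have key (n : ℕ) : ∀ v, lvl v = n → ∃ u, lvl u = 0 ∧ (levelGraph lvl).Reachable u v := by
    induction n with
    | zero => exact fun v hv => ⟨v, hv, .rfl⟩
    | succ n ih =>
      intro v hv
      obtain ⟨w, hw⟩ := h v (by omega)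
      obtain ⟨u, hu, huw⟩ := ih w (by omega)
      have hwv : (levelGraph lvl).Adj w v :=
        ⟨fun e => by rw [e] at hw; omega, by omega, by omega⟩
      exact ⟨u, hu, huw.trans hwv.reachable⟩
  refine connected_iff _ |>.2 ⟨fun u v => ?_, inferInstance⟩
  obtain ⟨u', hu', hu⟩ := key _ u rfl
  obtain ⟨v', hv', hv⟩ := key _ v rfl
  have : (levelGraph lvl).Reachable u' v' := by
    by_cases he : u' = v'
    · rw [he]
    · exact Adj.reachable ⟨he, by omega, by omega⟩
  exact hu.symm.trans (this.trans hv)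

variable [Fintype V] [DecidableRel (levelGraph lvl).Adj]

/-- The count is of the closed neighbourhood, so `φ` may take the value `v`. -/
theorem le_degree_levelGraph {δ : ℕ} (v : V) (φ : Fin (δ + 1) → V) (hφ : Function.Injective φ)
    (h : ∀ i, lvl (φ i) ≤ lvl v + 1 ∧ lvl v ≤ lvl (φ i) + 1) : δ ≤ (levelGraph lvl).degree v := by
  classical
  have hsub : Finset.univ.image φ ⊆ insert v ((levelGraph lvl).neighborFinset v) := by
    intro w hw
    obtain ⟨i, -, rfl⟩ := Finset.mem_image.1 hw
    rw [Finset.mem_insert, mem_neighborFinset, levelGraph_adj]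
    by_cases hi : φ i = v
    · exact .inl hi
    · exact .inr ⟨Ne.symm hi, (h i).2, (h i).1⟩
  have := (Finset.card_le_card hsub).trans (Finset.card_insert_le _ _)
  rw [Finset.card_image_of_injective _ hφ, Finset.card_univ, Fintype.card_fin,
    card_neighborFinset_eq_degree] at this
  omega

theorem degree_levelGraph_le {δ : ℕ} (v : V) (φ : Fin (δ + 1) → V)
    (h : ∀ w, lvl w ≤ lvl v + 1 → lvl v ≤ lvl w + 1 → w ∈ Set.range φ) :
    (levelGraph lvl).degree v ≤ δ := by
  classical
  have hsub : insert v ((levelGraph lvl).neighborFinset v) ⊆ Finset.univ.image φ := by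
    intro w hw
    rw [Finset.mem_insert, mem_neighborFinset, levelGraph_adj] at hw
    have : w ∈ Set.range φ := by
      rcases hw with rfl | hw
      · exact h w (by omega) (by omega)
      · exact h w hw.2.2 hw.2.1
    simpa using this
  have := (Finset.card_le_card hsub).trans Finset.card_image_le
  rw [Finset.card_insert_of_notMem (by simp), Finset.card_univ, Fintype.card_fin,
    card_neighborFinset_eq_degree] at this
  omega

end LevelGraph

/-- Levels for `m + 2` blocks of `δ + 1` vertices, on three levels each with a single vertex on
the first and the last one, and an extra vertex on the middle level of the two outer blocks. -/
def blockLevel (m δ : ℕ) : (Fin (m + 2) × Fin (δ + 1)) ⊕ Bool → ℕ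
  | .inl (j, i) => 3 * j + if (i : ℕ) = 0 then 0 else if (i : ℕ) = δ then 2 else 1
  | .inr false => 1
  | .inr true => 3 * m + 4

theorem exists_lvl_add_one_eq_blockLevel {m δ : ℕ} (hδ : 2 ≤ δ)
    (v : (Fin (m + 2) × Fin (δ + 1)) ⊕ Bool) (hv : 0 < blockLevel m δ v) :
    ∃ u, blockLevel m δ u + 1 = blockLevel m δ v := by
  have h0 : δ ≠ 0 := by omega
  have h1 : 1 ≠ δ := by omega
  rcases v with ⟨j, i⟩ | b
  · by_cases hi : (i : ℕ) = 0
    · simp only [blockLevel, hi, if_true] at hv ⊢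
      refine ⟨.inl (⟨j - 1, by omega⟩, Fin.last δ), ?_⟩
      simp only [Fin.val_last, h0, if_true, if_false]
      omega
    · by_cases hi' : (i : ℕ) = δ
      · exact ⟨.inl (j, ⟨1, by omega⟩), by simp [blockLevel, hi', h0, h1]⟩
      · exact ⟨.inl (j, 0), by simp [blockLevel, hi, hi']⟩
  · cases b
    · exact ⟨.inl (0, 0), by simp [blockLevel]⟩
    · exact ⟨.inl (Fin.last _, 0), by simp [blockLevel]; omega⟩

theorem minDegree_levelGraph_blockLevel {m δ : ℕ} (hδ : 2 ≤ δ)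
    [DecidableRel (levelGraph (blockLevel m δ)).Adj] :
    (levelGraph (blockLevel m δ)).minDegree = δ := by
  have h0 : δ ≠ 0 := by omega
  -- For an end vertex of a block, the opposite end is out of reach and is replaced by `w`, from the
  -- adjacent block or one of the two extra vertices.
  have upd (j : Fin (m + 2)) (k : Fin (δ + 1)) (w : (Fin (m + 2) × Fin (δ + 1)) ⊕ Bool)
      (hw : ∀ i, w ≠ .inl (j, i)) :
      Function.Injective (Function.update (fun i => Sum.inl (j, i)) k w) := by
    intro a b hab
    by_cases ha : a = k <;> by_cases hb : b = k
    · rw [ha, hb]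
    · subst ha
      rw [Function.update_self, Function.update_of_ne hb] at hab
      exact absurd hab (hw _)
    · subst hb
      rw [Function.update_self, Function.update_of_ne ha] at hab
      exact absurd hab.symm (hw _)
    · rw [Function.update_of_ne ha, Function.update_of_ne hb] at hab
      simpa using hab
  have blk (j : Fin (m + 2)) :
      Function.Injective fun i : Fin (δ + 1) => (Sum.inl (j, i) : _ ⊕ Bool) :=
    fun a b hab => by simpa using hab
  have hfirst {j : Fin (m + 2)} {i : Fin (δ + 1)} (hi : (i : ℕ) = 0) :
      blockLevel m δ (.inl (j, i)) = 3 * j := by simp [blockLevel, hi]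
  have hlast {j : Fin (m + 2)} {i : Fin (δ + 1)} (hi : (i : ℕ) = δ) :
      blockLevel m δ (.inl (j, i)) = 3 * j + 2 := by simp [blockLevel, hi, h0]
  have hmid {j : Fin (m + 2)} {i : Fin (δ + 1)} (hi : (i : ℕ) ≠ 0) (hi' : (i : ℕ) ≠ δ) :
      blockLevel m δ (.inl (j, i)) = 3 * j + 1 := by simp [blockLevel, hi, hi']
  have hge (j : Fin (m + 2)) (i : Fin (δ + 1)) : 3 * (j : ℕ) ≤ blockLevel m δ (.inl (j, i)) :=
    Nat.le_add_right _ _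
  have hle (j : Fin (m + 2)) (i : Fin (δ + 1)) :
      blockLevel m δ (.inl (j, i)) ≤ 3 * (j : ℕ) + 2 := by
    simp only [blockLevel]
    split_ifs <;> omega
  have hinit {j : Fin (m + 2)} {i : Fin (δ + 1)} (hi : i ≠ Fin.last δ) :
      blockLevel m δ (.inl (j, i)) ≤ 3 * (j : ℕ) + 1 := by
    have : (i : ℕ) ≠ δ := fun h => hi (Fin.ext h)
    simp only [blockLevel]
    split_ifs <;> omega
  have htail {j : Fin (m + 2)} {i : Fin (δ + 1)} (hi : i ≠ 0) :
      3 * (j : ℕ) + 1 ≤ blockLevel m δ (.inl (j, i)) := by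
    have : (i : ℕ) ≠ 0 := fun h => hi (Fin.ext h)
    simp only [blockLevel]
    split_ifs <;> omega
  have hfalse : blockLevel m δ (.inr false) = 1 := rfl
  have htrue : blockLevel m δ (.inr true) = 3 * m + 4 := rfl
  refine le_antisymm ?_ (le_minDegree_of_forall_le_degree _ _ fun v => ?_)
  -- The level 0 vertex sees its block without the last vertex, and the extra vertex: degree exactly
  -- δ.
  · refine (minDegree_le_degree _ (.inl (0, 0))).trans (degree_levelGraph_le _
      (Function.update (fun i => Sum.inl (0, i)) (Fin.last δ) (.inr false)) fun w hw _ => ?_)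
    rw [hfirst (by simp)] at hw
    simp only [Fin.val_zero, mul_zero, zero_add] at hw
    rcases w with ⟨j, i⟩ | b
    · have hj : j = 0 := by
        have := hge j i
        exact Fin.ext (by rw [Fin.val_zero]; omega)
      subst hj
      refine ⟨i, Function.update_of_ne (fun hi => ?_) _ _⟩
      rw [hlast (by simp [hi])] at hw
      omega
    · cases b
      · exact ⟨Fin.last δ, Function.update_self _ _ _⟩
      · omega
  · -- the first `δ` vertices of a block, or the last `δ` vertices, and another vertex
    have first (v w) (j : Fin (m + 2)) (hv : blockLevel m δ v = 3 * j)
        (hw : ∀ i, w ≠ .inl (j, i)) (h1 : blockLevel m δ w ≤ 3 * j + 1)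
        (h2 : 3 * j ≤ blockLevel m δ w + 1) : δ ≤ (levelGraph (blockLevel m δ)).degree v := by
      refine le_degree_levelGraph v _ (upd j (Fin.last δ) w hw) fun i => ?_
      by_cases hi : i = Fin.last δ
      · subst hi
        rw [Function.update_self]
        omega
      · rw [Function.update_of_ne hi]
        have := hge j i
        have := hinit (j := j) hi
        omega
    have last (v w) (j : Fin (m + 2)) (hv : blockLevel m δ v = 3 * j + 2)
        (hw : ∀ i, w ≠ .inl (j, i)) (h1 : blockLevel m δ w ≤ 3 * j + 3)
        (h2 : 3 * j + 1 ≤ blockLevel m δ w) : δ ≤ (levelGraph (blockLevel m δ)).degree v := by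
      refine le_degree_levelGraph v _ (upd j 0 w hw) fun i => ?_
      by_cases hi : i = 0
      · subst hi
        rw [Function.update_self]
        omega
      · rw [Function.update_of_ne hi]
        have := hle j i
        have := htail (j := j) hi
        omega
    have mid (v) (j : Fin (m + 2)) (hv : blockLevel m δ v = 3 * j + 1) :
        δ ≤ (levelGraph (blockLevel m δ)).degree v := by
      refine le_degree_levelGraph v _ (blk j) fun i => ?_
      have := hge j i
      have := hle j i
      omega
    rcases v with ⟨j, i⟩ | b
    · by_cases hi : (i : ℕ) = 0
      · by_cases hj : (j : ℕ) = 0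
        · exact first _ (.inr false) j (hfirst hi) (by simp) (by omega) (by omega)
        · have hw := hlast (j := ⟨j - 1, by omega⟩) (i := Fin.last δ) rfl
          simp only at hw
          refine first _ (.inl (⟨j - 1, by omega⟩, Fin.last δ)) j (hfirst hi) ?_
            (by omega) (by omega)
          intro i' h
          have := congrArg Fin.val (Prod.ext_iff.1 (Sum.inl_injective h)).1
          simp only at this
          omega
      · by_cases hi' : (i : ℕ) = δ
        · by_cases hj : (j : ℕ) = m + 1
          · exact last _ (.inr true) j (hlast hi') (by simp) (by omega) (by omega)
          · have hw := hfirst (j := ⟨j + 1, by omega⟩) (i := (0 : Fin (δ + 1))) rfl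
            simp only at hw
            refine last _ (.inl (⟨j + 1, by omega⟩, 0)) j (hlast hi') ?_ (by omega) (by omega)
            intro i' h
            have := congrArg Fin.val (Prod.ext_iff.1 (Sum.inl_injective h)).1
            simp only at this
            omega
        · exact mid _ j (hmid hi hi')
    · cases b
      · exact mid _ 0 (by simp [hfalse])
      · exact mid _ (Fin.last _) (by simp only [htrue, Fin.val_last]; omega)

theorem exists_connected_minDegree_eq_le_rainbowConnectionNumber {δ : ℕ} (hδ : 2 ≤ δ) (m : ℕ) :
    ∃ (G : SimpleGraph (Fin ((m + 2) * (δ + 1) + 2))) (_ : DecidableRel G.Adj),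
      G.Connected ∧ G.minDegree = δ ∧ 3 * m + 5 ≤ G.rainbowConnectionNumber := by
  classical
  let e : Fin ((m + 2) * (δ + 1) + 2) ≃ (Fin (m + 2) × Fin (δ + 1)) ⊕ Bool :=
    Fintype.equivOfCardEq (by simp)
  let f : levelGraph (blockLevel m δ ∘ e) ≃g levelGraph (blockLevel m δ) :=
    { toEquiv := e
      map_rel_iff' := by simp [levelGraph_adj] }
  have hconn : (levelGraph (blockLevel m δ ∘ e)).Connected :=
    f.connected_iff.2 (levelGraph_connected (exists_lvl_add_one_eq_blockLevel hδ))
  refine ⟨levelGraph (blockLevel m δ ∘ e), Classical.decRel _, hconn, ?_, ?_⟩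
  · exact f.minDegree_eq.trans (minDegree_levelGraph_blockLevel hδ)
  -- The extreme levels are 0 and 3(m + 1) + 2 = 3m + 5.
  · obtain ⟨p, hp⟩ := (rainbowColorable_rainbowConnectionNumber _ hconn).exists_walk_length_le
      (e.symm (.inl (0, 0))) (e.symm (.inl (Fin.last _, Fin.last _)))
    have := levelGraph_le_length p
    have h0 : δ ≠ 0 := by omega
    simp only [Function.comp_apply, Equiv.apply_symm_apply, blockLevel, Fin.val_last, h0,
      Fin.val_zero, if_true, if_false] at this
    omega

end SimpleGraph

theorem mainTheorem1 :
    (∀ {V : Type*} [Fintype V] (G : SimpleGraph V) [DecidableRel G.Adj], G.Connected →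
      (G.rainbowConnectionNumber : ℝ) ≤
        3 * (Fintype.card V : ℝ) / ((G.minDegree : ℝ) + 1) + 3) ∧
    (∀ δ : ℕ, 2 ≤ δ →
      {n : ℕ | ∃ (G : SimpleGraph (Fin n)) (_ : DecidableRel G.Adj),
        G.Connected ∧ G.minDegree = δ ∧
        3 * ((n : ℝ) - 2) / ((δ : ℝ) + 1) - 1 ≤ (G.rainbowConnectionNumber : ℝ)}.Infinite) := by
  refine ⟨fun G _ hG => G.rainbowConnectionNumber_le hG, fun δ hδ => ?_⟩
  refine Set.infinite_of_injective_forall_mem (f := fun m : ℕ => (m + 2) * (δ + 1) + 2) ?_ ?_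
  · intro a b hab
    simpa using hab
  · intro m
    obtain ⟨G, inst, hG, hmin, hle⟩ :=
      SimpleGraph.exists_connected_minDegree_eq_le_rainbowConnectionNumber hδ m
    refine ⟨G, inst, hG, hmin, ?_⟩
    have hle' : (3 * m + 5 : ℝ) ≤ G.rainbowConnectionNumber := by exact_mod_cast hle
    -- The two extra vertices account for n - 2, and 3(m + 2) - 1 is exactly 3m + 5.
    have : 3 * (((((m + 2) * (δ + 1) + 2 : ℕ) : ℕ) : ℝ) - 2) / ((δ : ℝ) + 1) = 3 * (m + 2) := by
      push_cast
      field_simp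
      ring
    rw [this]
    linarith
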